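/- Let $D$ be an integral domain with quotient field $K$. An overring of $D$ is a ring $T$ with $D\subseteq T\subseteq K$. A semistar operation on $D$ is a map $I\mapsto I^\star$ on the set of $D$-submodules of $K$ such that, for all $D$-submodules $I,J$ of $K$ and all $x\in K$: $I\subseteq I^\star$; $I\subseteq J$ implies $I^\star\subseteq J^\star$; $(I^\star)^\star=I^\star$; $x\cdot I^\star=(xI)^\star$. It is stable if $(I\cap J)^\star=I^\star\cap J^\star$ for all $I,J$. Let $\mathrm{Stab}(D)$ be the set of stable semistar operations on $D$, ordered by $\star_1\le\star_2$ iff $I^{\star_1}\subseteq I^{\star_2}$ for all $I$. For an overring $T$ of $D$, the restriction $\star|_T$ of $\star\in\mathrm{Stab}(D)$ to the $T$-submodules of $K$ is an element of $\mathrm{Stab}(T)$. A Jaffard family of $D$ is a set $\Theta$ of overrings of $D$, all flat over $D$, such that: either $K\notin\Theta$ or $\Theta=\{K\}$; $I=\bigcap_{T\in\Theta}IT$ for every ideal $I$ of $D$; for distinct $A,B\in\Theta$ the only prime of $D$ that is contracted both from a prime of $A$ and from a prime of $B$ is $(0)$; and every nonzero $x\in K$ is a nonunit in only finitely many members of $\Theta$.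 A Jaffard overring of $D$ is a member of a Jaffard family of $D$. For a set $\Theta$ of overrings of $D$, define by transfinite recursion $\Theta_0=\Theta$, $T_\alpha=\bigcap_{S\in\Theta_\alpha}S$ (with $T_\alpha=K$ if $\Theta_\alpha=\emptyset$), $\Theta_{\alpha+1}=\{S\in\Theta_\alpha\mid S\text{ is not a Jaffard overring of }T_\alpha\}$, and $\Theta_\alpha=\bigcap_{\beta<\alpha}\Theta_\beta$ for a limit ordinal $\alpha$. The family $\Theta$ is sharp if $T_\alpha=K$, where $\alpha$ is the least ordinal with $T_{\alpha'}=T_\alpha$ for all $\alpha'>\alpha$. A one-dimensional domain $D$ is ultimately sharp if $\{D_M\mid M\in\mathrm{Max}(D)\}$ is sharp. The domain $D$ is almost Dedekind if $D_M$ is a discrete valuation ring (not a field) for every $M\in\mathrm{Max}(D)$. **Corollary.** Let $D$ be an almost Dedekind domain that is ultimately sharp. Then: 1. the map $\star\mapsto(\star|_{D_M})_{M}$ is an order isomorphism $\mathrm{Stab}(D)\to\prod_{M\in\mathrm{Max}(D)}\mathrm{Stab}(D_M)$, whose inverse sends $(\star^{(M)})_M$ to the operation $I\mapsto\bigcap_{M}(ID_M)^{\star^{(M)}}$;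 2. for every $M\in\mathrm{Max}(D)$, the set $\mathrm{Stab}(D_M)$ has exactly two elements: the identity, and the operation sending every nonzero submodule to $K$; 3. the map $\star\mapsto\{M\in\mathrm{Max}(D)\mid \star|_{D_M}\text{ is the identity}\}$ is a bijection from $\mathrm{Stab}(D)$ onto the power set of $\mathrm{Max}(D)$; its inverse sends $S\subseteq\mathrm{Max}(D)$ to the operation with $I\mapsto\bigcap_{M\in S}ID_M$ for all $I\neq(0)$ (so $I\mapsto K$ if $S=\emptyset$). -/

import Mathlib

open scoped Pointwise

universe u v

noncomputable section

/-- A domain all of whose localizations at maximal ideals are discrete valuation rings.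
A field is not almost Dedekind in this sense (almost Dedekind domains are one-dimensional). -/
def IsAlmostDedekind (D : Type v) [CommRing D] [IsDomain D] : Prop :=
  ∀ M : MaximalSpectrum D, IsDiscreteValuationRing (Localization.AtPrime M.asIdeal)

section Overrings

/-! Overrings of `D` are the `D`-subalgebras of its quotient field `K`. -/

variable {D : Type v} {K : Type u} [CommRing D] [Field K] [Algebra D K]

/-- The product `IT`, i.e. the `T`-submodule of `K` generated by `I`. -/
def extendTo (I : Submodule D K) (T : Subalgebra D K) : Submodule T K :=
  Submodule.span T (I : Set K)

/-- `σ(T)`: the contractions to `D` of the prime ideals of `T`. -/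
def sigmaSet (T : Subalgebra D K) : Set (PrimeSpectrum D) :=
  Set.range (PrimeSpectrum.comap (algebraMap D T))

/-- `I = ⋂ IT` for every ideal `I` of `D`, the ideals being viewed inside `K`. -/
def IsCompleteFamily (Θ : Set (Subalgebra D K)) : Prop :=
  ∀ I : Ideal D, Submodule.map (Algebra.linearMap D K) I =
    ⨅ T ∈ Θ, (extendTo (Submodule.map (Algebra.linearMap D K) I) T).restrictScalars D

/-- Distinct members have only the zero prime in common. -/
def IsIndependentFamily (Θ : Set (Subalgebra D K)) : Prop :=
  ∀ A ∈ Θ, ∀ B ∈ Θ, A ≠ B → sigmaSet A ∩ sigmaSet B = {P | P.asIdeal = ⊥}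

/-- Every nonzero `x` in `K` is a unit in all but finitely many members. -/
def IsLocallyFiniteFamily (Θ : Set (Subalgebra D K)) : Prop :=
  ∀ x : K, x ≠ 0 → {T ∈ Θ | ¬ (x ∈ T ∧ x⁻¹ ∈ T)}.Finite

/-- Jaffard families of overrings of `D`. -/
structure IsJaffardFamily (Θ : Set (Subalgebra D K)) : Prop where
  top_notMem_or : ⊤ ∉ Θ ∨ Θ = {⊤}
  flat : ∀ T ∈ Θ, Module.Flat D T
  complete : IsCompleteFamily Θ
  independent : IsIndependentFamily Θ
  locallyFinite : IsLocallyFiniteFamily Θ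

/-- An overring of `D` is a Jaffard overring if it belongs to a Jaffard family of `D`. -/
def IsJaffardOverring (T : Subalgebra D K) : Prop :=
  ∃ Θ : Set (Subalgebra D K), IsJaffardFamily Θ ∧ T ∈ Θ

/-- `S` contains the overring `T` of `D`, and is a Jaffard overring of the domain `T`. -/
def IsJaffardOverringOf (T S : Subalgebra D K) : Prop :=
  ∃ S' : Subalgebra T K, S'.restrictScalars D = S ∧ IsJaffardOverring S'

/-- `Θ_α`: at a successor step the members that are Jaffard overrings of
`T_γ = ⋂ Θ_γ` are removed, and at a limit step the intersection is taken. -/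
def derivedFamily (Θ : Set (Subalgebra D K)) (α : Ordinal.{u}) : Set (Subalgebra D K) :=
  Ordinal.limitRecOn (motive := fun _ => Set (Subalgebra D K)) α
    Θ
    (fun _ Θγ => {S ∈ Θγ | ¬ IsJaffardOverringOf (sInf Θγ) S})
    (fun α _ ih => {S | ∀ (β : Ordinal.{u}) (h : β < α), S ∈ ih β h})

/-- The derived sequence `T_α = ⋂ Θ_α`; it is `⊤ = K` if `Θ_α` is empty. -/
def derivedRing (Θ : Set (Subalgebra D K)) (α : Ordinal.{u}) : Subalgebra D K :=
  sInf (derivedFamily Θ α)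

/-- The least ordinal from which on the derived sequence is constant. -/
def jaffardDegree (Θ : Set (Subalgebra D K)) : Ordinal.{u} :=
  sInf {α | ∀ α' > α, derivedRing Θ α' = derivedRing Θ α}

/-- The stable value of the derived sequence. -/
def dullLimit (Θ : Set (Subalgebra D K)) : Subalgebra D K :=
  derivedRing Θ (jaffardDegree Θ)

/-- A family is sharp if its dull limit is `K`. -/
def IsSharpFamily (Θ : Set (Subalgebra D K)) : Prop :=
  dullLimit Θ = ⊤

end Overrings

section Localizations

variable {D : Type v} (K : Type u) [CommRing D] [IsDomain D] [Field K] [Algebra D K]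
  [IsFractionRing D K]

/-- The localization `D_M` as an overring of `D`. -/
abbrev locAt (M : MaximalSpectrum D) : Subalgebra D K :=
  Localization.subalgebra.ofField K M.asIdeal.primeCompl
    M.asIdeal.primeCompl_le_nonZeroDivisors

variable (D) in
/-- The one-dimensional domain `D` is ultimately sharp if `{D_M | M ∈ Max(D)}` is sharp. -/
def IsUltimatelySharp : Prop :=
  IsSharpFamily (Set.range (locAt K : MaximalSpectrum D → Subalgebra D K))

end Localizations

section Semistar

/-- Semistar operations on `D`: closure operations on the `D`-submodules of `K` that
commute with multiplication by elements of `K`. -/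
@[ext]
structure SemistarOperation (D : Type v) (K : Type u) [CommRing D] [Field K] [Algebra D K] where
  toFun : Submodule D K → Submodule D K
  le_toFun : ∀ I, I ≤ toFun I
  mono : ∀ I J, I ≤ J → toFun I ≤ toFun J
  idem : ∀ I, toFun (toFun I) = toFun I
  smul : ∀ (x : K) (I), x • toFun I = toFun (x • I)

variable {D : Type v} {K : Type u} [CommRing D] [Field K] [Algebra D K]

/-- A semistar operation is stable if it commutes with binary intersections. -/
def SemistarOperation.IsStable (s : SemistarOperation D K) : Prop :=
  ∀ I J, s.toFun (I ⊓ J) = s.toFun I ⊓ s.toFun J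

instance : PartialOrder (SemistarOperation D K) where
  le s t := ∀ I, s.toFun I ≤ t.toFun I
  le_refl _ _ := le_rfl
  le_trans _ _ _ h h' I := (h I).trans (h' I)
  le_antisymm _ _ h h' := SemistarOperation.ext (funext fun I => le_antisymm (h I) (h' I))

variable (D K) in
/-- The ordered set of stable semistar operations on `D`. -/
abbrev StableSemistar : Type u :=
  {s : SemistarOperation D K // s.IsStable}

/-- The restriction of a semistar operation to the `T`-submodules of `K`. -/
def SemistarOperation.restrict (s : SemistarOperation D K) (T : Subalgebra D K) :
    SemistarOperation T K where
  toFun I :=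
    { (s.toFun (I.restrictScalars D)).toAddSubmonoid with
      smul_mem' := by
        intro c x hx
        have h : (c : K) • I.restrictScalars D ≤ I.restrictScalars D := by
          rintro _ ⟨y, hy, rfl⟩
          exact I.smul_mem c hy
        have h2 : (c : K) * x ∈ (c : K) • s.toFun (I.restrictScalars D) :=
          Submodule.smul_mem_pointwise_smul x (c : K) _ hx
        rw [s.smul] at h2
        exact s.mono _ _ h h2 }
  le_toFun I x hx := s.le_toFun (I.restrictScalars D) hx
  mono I J h x hx := s.mono (I.restrictScalars D) (J.restrictScalars D) h hx
  idem I := by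
    ext x
    exact SetLike.ext_iff.1 (s.idem (I.restrictScalars D)) x
  smul x I := by
    ext y
    exact SetLike.ext_iff.1 (s.smul x (I.restrictScalars D)) y

/-- The restriction of a stable semistar operation to an overring, as a stable operation. -/
def StableSemistar.restrict (s : StableSemistar D K) (T : Subalgebra D K) :
    StableSemistar T K :=
  ⟨s.1.restrict T, fun I J => by
    ext x
    exact SetLike.ext_iff.1 (s.2 (I.restrictScalars D) (J.restrictScalars D)) x⟩

end Semistar

end

/-!
Let `s` be stable on `D` and let `x` lie in `s (I D_N)` for every maximal `N`. Sharpness removes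
every `D_M` from the derived sequence at some stage, and `x ∈ s(I) D_M` follows by induction on that
stage: a Jaffard overring `D_M` of `T_α` is isolated among the localizations containing `T_α`, so
some `b ∉ M` makes `b x` lie in `s(I) D_N` for all `N ≠ M`, and stability puts `b x` in `s(I)`.
Hence `s(I)` is the intersection of the `s (I D_M)`, that is, `s` is determined by its restrictions.

In a one-dimensional Noetherian local ring every nonzero principal ideal contains a power of any
given proper ideal `J`. A stable operation other than the identity satisfies `1 ∈ s(J)` for some
proper `J`, hence `1 ∈ s(a R)` for every `a ≠ 0`, so it sends all nonzero submodules to `K`.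
-/

section Submodules

variable {R K : Type*} [CommRing R] [Field K] [Algebra R K]

theorem mem_pointwise_smul_iff_inv_mul_mem {x z : K} (hx : x ≠ 0) {I : Submodule R K} :
    z ∈ x • I ↔ x⁻¹ * z ∈ I :=
  Set.mem_smul_set_iff_inv_smul_mem₀ hx (I : Set K) z

theorem zero_pointwise_smul (I : Submodule R K) : (0 : K) • I = ⊥ := by
  rw [eq_bot_iff]
  rintro _ ⟨y, -, rfl⟩
  exact zero_mul y

theorem pointwise_smul_top {x : K} (hx : x ≠ 0) : x • (⊤ : Submodule R K) = ⊤ :=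
  eq_top_iff.2 fun _ _ => (mem_pointwise_smul_iff_inv_mul_mem hx).2 Submodule.mem_top

theorem pointwise_smul_ne_bot {x : K} (hx : x ≠ 0) {I : Submodule R K} (hI : I ≠ ⊥) :
    x • I ≠ ⊥ := by
  obtain ⟨y, hy, hy0⟩ := I.exists_mem_ne_zero_of_ne_bot hI
  exact (Submodule.ne_bot_iff _).2
    ⟨x * y, Submodule.smul_mem_pointwise_smul y x I hy, mul_ne_zero hx hy0⟩

theorem exists_ne_zero_smul_mem_of_ne_bot [IsFractionRing R K] {I : Submodule R K} (hI : I ≠ ⊥)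
    (x : K) : ∃ d : R, d ≠ 0 ∧ d • x ∈ I := by
  obtain ⟨y, hy, hy0⟩ := I.exists_mem_ne_zero_of_ne_bot hI
  obtain ⟨a, d, hd, hxy⟩ := IsFractionRing.div_surjective R (x / y)
  have := (algebraMap R K).domain_nontrivial
  have hd0 := IsFractionRing.to_map_ne_zero_of_mem_nonZeroDivisors (K := K) hd
  refine ⟨d, nonZeroDivisors.ne_zero hd, ?_⟩
  have hdx : d • x = a • y := by
    rw [Algebra.smul_def, Algebra.smul_def, mul_comm, (div_eq_div_iff hd0 hy0).1 hxy]
  exact hdx ▸ I.smul_mem a hy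

theorem inf_ne_bot [IsFractionRing R K] {I J : Submodule R K} (hI : I ≠ ⊥) (hJ : J ≠ ⊥) :
    I ⊓ J ≠ ⊥ := by
  obtain ⟨z, hz, hz0⟩ := J.exists_mem_ne_zero_of_ne_bot hJ
  obtain ⟨d, hd, hdz⟩ := exists_ne_zero_smul_mem_of_ne_bot hI z
  refine (Submodule.ne_bot_iff _).2 ⟨d • z, ⟨hdz, J.smul_mem d hz⟩, ?_⟩
  rw [Algebra.smul_def]
  exact mul_ne_zero ((map_ne_zero_iff _ (IsFractionRing.injective R K)).2 hd) hz0

variable {D : Type v} {K : Type u} [CommRing D] [Field K] [Algebra D K]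

theorem extendTo_bot (T : Subalgebra D K) : extendTo (⊥ : Submodule D K) T = ⊥ :=
  Submodule.span_zero_singleton T

theorem le_extendTo (I : Submodule D K) (T : Subalgebra D K) :
    I ≤ (extendTo I T).restrictScalars D :=
  fun _ h => Submodule.subset_span h

theorem extendTo_ne_bot {I : Submodule D K} (hI : I ≠ ⊥) (T : Subalgebra D K) :
    extendTo I T ≠ ⊥ := by
  obtain ⟨y, hy, hy0⟩ := I.exists_mem_ne_zero_of_ne_bot hI
  exact (Submodule.ne_bot_iff _).2 ⟨y, le_extendTo I T hy, hy0⟩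

theorem extendTo_mono {I J : Submodule D K} (h : I ≤ J) (T : Subalgebra D K) :
    extendTo I T ≤ extendTo J T :=
  Submodule.span_mono h

theorem extendTo_restrictScalars (T : Subalgebra D K) (I : Submodule T K) :
    extendTo (I.restrictScalars D) T = I :=
  Submodule.span_eq I

theorem extendTo_smul (x : K) (I : Submodule D K) (T : Subalgebra D K) :
    extendTo (x • I) T = x • extendTo I T :=
  (Submodule.smul_span x (I : Set K)).symm

end Submodules

section Semistar

variable {D : Type v} {K : Type u} [CommRing D] [Field K] [Algebra D K]

namespace SemistarOperation

variable (s : SemistarOperation D K)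

theorem toFun_bot : s.toFun ⊥ = ⊥ := by
  simpa only [zero_pointwise_smul] using (s.smul 0 ⊥).symm

theorem toFun_top : s.toFun ⊤ = ⊤ :=
  top_le_iff.1 (s.le_toFun ⊤)

theorem mul_toFun_le (I J : Submodule D K) : I * s.toFun J ≤ s.toFun (I * J) := by
  refine Submodule.mul_le.2 fun x hx y hy => ?_
  have hxJ : x • J ≤ I * J := by
    rintro _ ⟨z, hz, rfl⟩
    exact Submodule.mul_mem_mul hx hz
  exact s.mono _ _ hxJ (s.smul x J ▸ Submodule.smul_mem_pointwise_smul y x _ hy)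

variable {s}

theorem one_mem_toFun_pow {I : Submodule D K} (h : 1 ∈ s.toFun I) (n : ℕ) :
    1 ∈ s.toFun (I ^ n) := by
  induction n with
  | zero => exact s.le_toFun _ (Submodule.one_le.1 (pow_zero I).ge)
  | succ n ih =>
    have hle : I ≤ s.toFun (I ^ (n + 1)) := fun x hx => by
      rw [pow_succ']
      simpa only [mul_one] using s.mul_toFun_le I (I ^ n) (Submodule.mul_mem_mul hx ih)
    exact s.idem (I ^ (n + 1)) ▸ s.mono _ _ hle h

theorem toFun_eq_top_of_toFun_one_eq_top (h : s.toFun 1 = ⊤) {J : Submodule D K} (hJ : J ≠ ⊥) :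
    s.toFun J = ⊤ := by
  obtain ⟨y, hy, hy0⟩ := J.exists_mem_ne_zero_of_ne_bot hJ
  refine eq_top_iff.2 fun z _ => ?_
  have hz : y⁻¹ * z ∈ s.toFun 1 := h ▸ Submodule.mem_top
  simpa only [mul_one, mul_inv_cancel_left₀ hy0] using
    s.mul_toFun_le J 1 (Submodule.mul_mem_mul hy hz)

end SemistarOperation

namespace StableSemistar

@[ext]
theorem ext {s t : StableSemistar D K} (h : ∀ I, s.1.toFun I = t.1.toFun I) : s = t :=
  Subtype.ext (SemistarOperation.ext (funext h))

variable (D K)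

/-- The identity `I ↦ I` as a stable semistar operation. -/
def identity : StableSemistar D K :=
  ⟨{  toFun I := I
      le_toFun _ := le_rfl
      mono _ _ h := h
      idem _ := rfl
      smul _ _ := rfl }, fun _ _ => rfl⟩

open scoped Classical in
/-- The largest semistar operation, sending every nonzero submodule to `K`. The zero submodule is
fixed by every semistar operation. -/
noncomputable def trivial [IsFractionRing D K] : StableSemistar D K :=
  ⟨{  toFun I := if I = ⊥ then ⊥ else ⊤
      le_toFun I := by split_ifs with h <;> simp [h]
      mono I J h := by
        by_cases hJ : J = ⊥
        · simp [le_bot_iff.1 (hJ ▸ h)]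
        · simp [hJ]
      idem I := by by_cases hI : I = ⊥ <;> simp [hI]
      smul x I := by
        rcases eq_or_ne x 0 with rfl | hx
        · simp
        by_cases hI : I = ⊥
        · simp [hI, Submodule.smul_bot' x]
        · simp [hI, pointwise_smul_ne_bot hx hI, pointwise_smul_top hx] }, fun I J => by
    by_cases hI : I = ⊥
    · simp [hI]
    by_cases hJ : J = ⊥
    · simp [hJ]
    simp [hI, hJ, inf_ne_bot hI hJ]⟩

variable {D K}

theorem identity_toFun (I : Submodule D K) : (identity D K).1.toFun I = I :=
  rfl

theorem eq_identity_iff {s : StableSemistar D K} : s = identity D K ↔ ∀ I, s.1.toFun I = I :=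
  ⟨fun h => h ▸ identity_toFun, fun h => ext h⟩

theorem trivial_toFun [IsFractionRing D K] {I : Submodule D K} (hI : I ≠ ⊥) :
    (trivial D K).1.toFun I = ⊤ :=
  if_neg hI

theorem eq_trivial_of_toFun_one_eq_top [IsFractionRing D K] {s : StableSemistar D K}
    (h : s.1.toFun 1 = ⊤) : s = trivial D K := by
  ext1 I
  rcases eq_or_ne I ⊥ with rfl | hI
  · rw [s.1.toFun_bot, (trivial D K).1.toFun_bot]
  · rw [SemistarOperation.toFun_eq_top_of_toFun_one_eq_top h hI, trivial_toFun hI]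

end StableSemistar

end Semistar

section Localizations

variable {D : Type v} {K : Type u} [CommRing D] [IsDomain D] [Field K] [Algebra D K]
  [IsFractionRing D K] {M N : MaximalSpectrum D}

theorem mem_locAt_iff {z : K} :
    z ∈ locAt K M ↔ ∃ c ∉ M.asIdeal, ∃ a, c • z = algebraMap D K a := by
  have hne {c : D} (hc : c ∉ M.asIdeal) : algebraMap D K c ≠ 0 :=
    (map_ne_zero_iff _ (IsFractionRing.injective D K)).2
      fun h => hc (h ▸ M.asIdeal.zero_mem)
  constructor
  · rintro ⟨a, c, hc, rfl⟩
    exact ⟨c, hc, a, by rw [Algebra.smul_def, mul_left_comm, mul_inv_cancel₀ (hne hc), mul_one]⟩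
  · rintro ⟨c, hc, a, h⟩
    exact ⟨a, c, hc, by rw [← h, Algebra.smul_def, mul_comm, inv_mul_cancel_left₀ (hne hc)]⟩

theorem locAt_ne_top (hM : M.asIdeal ≠ ⊥) : locAt K M ≠ ⊤ := by
  obtain ⟨d, hd, hd0⟩ := Submodule.exists_mem_ne_zero_of_ne_bot hM
  have hd0K : algebraMap D K d ≠ 0 := (map_ne_zero_iff _ (IsFractionRing.injective D K)).2 hd0
  intro h
  have hmem : (algebraMap D K d)⁻¹ ∈ locAt K M := h ▸ Algebra.mem_top
  obtain ⟨c, hc, a, hca⟩ := mem_locAt_iff.1 hmem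
  rw [Algebra.smul_def, mul_inv_eq_iff_eq_mul₀ hd0K, ← map_mul] at hca
  exact hc (IsFractionRing.injective D K hca ▸ M.asIdeal.mul_mem_left a hd)

theorem extendTo_locAt_eq_localized' (I : Submodule D K) (M : MaximalSpectrum D) :
    haveI := isLocalizedModule_id M.asIdeal.primeCompl K (locAt K M)
    extendTo I (locAt K M) = I.localized' (locAt K M) M.asIdeal.primeCompl LinearMap.id := by
  have := isLocalizedModule_id M.asIdeal.primeCompl K (locAt K M)
  rw [Submodule.localized'_eq_span, LinearMap.id_coe, Set.image_id]
  rfl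

theorem mem_extendTo_locAt {I : Submodule D K} {z : K} :
    z ∈ extendTo I (locAt K M) ↔ ∃ c ∉ M.asIdeal, c • z ∈ I := by
  have := isLocalizedModule_id M.asIdeal.primeCompl K (locAt K M)
  simp only [extendTo_locAt_eq_localized', Submodule.mem_localized', IsLocalizedModule.mk'_eq_iff]
  constructor
  · rintro ⟨y, hy, c, rfl : y = c.1 • z⟩
    exact ⟨c, c.2, hy⟩
  · rintro ⟨c, hc, h⟩
    exact ⟨_, h, ⟨c, hc⟩, rfl⟩

theorem extendTo_locAt_inf (I J : Submodule D K) (M : MaximalSpectrum D) :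
    extendTo (I ⊓ J) (locAt K M) = extendTo I (locAt K M) ⊓ extendTo J (locAt K M) := by
  have := isLocalizedModule_id M.asIdeal.primeCompl K (locAt K M)
  simp only [extendTo_locAt_eq_localized', Submodule.localized'_inf]

theorem mem_of_forall_mem_extendTo_locAt {I : Submodule D K} {x : K}
    (h : ∀ M : MaximalSpectrum D, x ∈ extendTo I (locAt K M)) : x ∈ I := by
  have hK (P : Ideal D) [hP : P.IsMaximal] :
      IsLocalizedModule P.primeCompl (LinearMap.id : K →ₗ[D] K) :=
    isLocalizedModule_id P.primeCompl K (locAt K ⟨P, hP⟩)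
  refine @Submodule.mem_of_localization_maximal D K _ _ _ (fun _ _ => K) _ _ (fun _ _ => .id) hK x I
    fun P hP => ?_
  obtain ⟨c, hc, hcx⟩ := mem_extendTo_locAt.1 (h ⟨P, hP⟩)
  exact ⟨c • x, hcx, ⟨c, hc⟩, IsLocalizedModule.mk'_eq_iff.2 rfl⟩

end Localizations

section Primes

variable {D : Type v} {K : Type u} [CommRing D] [Field K] [Algebra D K]

theorem sigmaSet_restrictScalars {T : Subalgebra D K} (A : Subalgebra T K) :
    sigmaSet (A.restrictScalars D) = PrimeSpectrum.comap (algebraMap D T) '' sigmaSet A :=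
  Set.range_comp (PrimeSpectrum.comap (algebraMap D T)) (PrimeSpectrum.comap (algebraMap T A))

/-- In dimension one, a prime not lying below any prime of `A` becomes invisible in `A`: every
nonzero ideal of `A` meets its complement. -/
theorem exists_notMem_smul_mem_of_notMem_sigmaSet [IsFractionRing D K] [Ring.DimensionLEOne D]
    {A : Subalgebra D K} {M : MaximalSpectrum D} (hM : M.toPrimeSpectrum ∉ sigmaSet A) (x : K) :
    ∃ b ∉ M.asIdeal, b • x ∈ A := by
  have := (algebraMap D K).domain_nontrivial
  obtain ⟨a, d, hd, rfl⟩ := IsFractionRing.div_surjective D x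
  have hd0 := IsFractionRing.to_map_ne_zero_of_mem_nonZeroDivisors (K := K) hd
  suffices ¬ Disjoint (Ideal.span {algebraMap D A d} : Set A)
      (M.asIdeal.primeCompl.map (algebraMap D A)) by
    obtain ⟨_, hy, b, hb, rfl⟩ := Set.not_disjoint_iff.1 this
    obtain ⟨r, hr⟩ := Ideal.mem_span_singleton'.1 hy
    have hrK : (r : K) * algebraMap D K d = algebraMap D K b := congrArg Subtype.val hr
    refine ⟨b, hb, ?_⟩
    rw [Algebra.smul_def, ← hrK, mul_assoc, mul_div_cancel₀ _ hd0]
    exact A.mul_mem r.2 (A.algebraMap_mem a)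
  intro hdisj
  obtain ⟨Q, hQ, hdQ, hQdisj⟩ := Ideal.exists_le_prime_disjoint _ _ hdisj
  have hne : Q.comap (algebraMap D A) ≠ ⊥ := (Submodule.ne_bot_iff _).2
    ⟨d, hdQ (Ideal.mem_span_singleton_self _), nonZeroDivisors.ne_zero hd⟩
  have hle : Q.comap (algebraMap D A) ≤ M.asIdeal := fun c hc => by_contra fun hcM =>
    Set.disjoint_left.1 hQdisj hc ⟨c, hcM, rfl⟩
  have hmax : (Q.comap (algebraMap D A)).IsMaximal :=
    Ring.DimensionLEOne.maximalOfPrime hne inferInstance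
  exact hM ⟨⟨Q, hQ⟩, PrimeSpectrum.ext (hmax.eq_of_le M.isMaximal.ne_top hle)⟩

variable {M N : MaximalSpectrum D}

theorem mem_prime_iff_of_smul_eq_algebraMap {A : Type*} [CommRing A] [Algebra D A]
    {P : PrimeSpectrum A} (hP : P.comap (algebraMap D A) = M.toPrimeSpectrum) {c b : D}
    (hc : c ∉ M.asIdeal) {t : A} (h : c • t = algebraMap D A b) :
    t ∈ P.asIdeal ↔ b ∈ M.asIdeal := by
  have hmem (d : D) : algebraMap D A d ∈ P.asIdeal ↔ d ∈ M.asIdeal :=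
    SetLike.ext_iff.1 (congrArg PrimeSpectrum.asIdeal hP) d
  rw [← hmem b, ← h, Algebra.smul_def, P.2.mul_mem_left_iff (mt (hmem c).1 hc)]

variable [IsDomain D] [IsFractionRing D K]

theorem eq_of_comap_eq_of_le_locAt {T : Subalgebra D K} (hT : T ≤ locAt K M)
    {P Q : PrimeSpectrum T} (hP : P.comap (algebraMap D T) = M.toPrimeSpectrum)
    (hQ : Q.comap (algebraMap D T) = M.toPrimeSpectrum) : P = Q := by
  ext t
  obtain ⟨c, hc, b, h⟩ := mem_locAt_iff.1 (hT t.2)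
  have ht : c • t = algebraMap D T b := Subtype.ext h
  rw [mem_prime_iff_of_smul_eq_algebraMap hP hc ht, mem_prime_iff_of_smul_eq_algebraMap hQ hc ht]

theorem mem_sigmaSet_of_le_locAt {T : Subalgebra D K} (hT : T ≤ locAt K M) :
    M.toPrimeSpectrum ∈ sigmaSet T := by
  have := IsLocalization.AtPrime.isLocalRing (locAt K M) M.asIdeal
  refine ⟨(IsLocalRing.closedPoint (locAt K M)).comap (Subalgebra.inclusion hT).toRingHom,
    PrimeSpectrum.ext ?_⟩
  exact IsLocalization.AtPrime.under_maximalIdeal (locAt K M) M.asIdeal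

theorem eq_of_mem_sigmaSet_locAt (h : M.toPrimeSpectrum ∈ sigmaSet (locAt K N)) : M = N := by
  obtain ⟨P, hP⟩ := h
  refine MaximalSpectrum.ext (M.isMaximal.eq_of_le N.isMaximal.ne_top fun c hc => ?_)
  have hcP : algebraMap D (locAt K N) c ∈ P.asIdeal :=
    (SetLike.ext_iff.1 (congrArg PrimeSpectrum.asIdeal hP) c).2 hc
  by_contra hcN
  exact P.2.ne_top (Ideal.eq_top_of_isUnit_mem _ hcP
    (IsLocalization.map_units (locAt K N) (⟨c, hcN⟩ : N.asIdeal.primeCompl)))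

theorem eq_of_locAt_le_locAt (h : locAt K M ≤ locAt K N) : M = N :=
  (eq_of_mem_sigmaSet_locAt (mem_sigmaSet_of_le_locAt h)).symm

theorem extendTo_locAt_eq_top_of_ne [Ring.DimensionLEOne D] (hMN : M ≠ N)
    {I : Submodule (locAt K M) K} (hI : I ≠ ⊥) :
    extendTo (I.restrictScalars D) (locAt K N) = ⊤ := by
  obtain ⟨y, hy, hy0⟩ := I.exists_mem_ne_zero_of_ne_bot hI
  refine eq_top_iff.2 fun x _ => ?_
  obtain ⟨b, hb, hbx⟩ := exists_notMem_smul_mem_of_notMem_sigmaSet (A := locAt K M)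
    (mt eq_of_mem_sigmaSet_locAt hMN.symm) (x / y)
  refine mem_extendTo_locAt.2 ⟨b, hb, ?_⟩
  have hbxy : b • x = (⟨_, hbx⟩ : locAt K M) • y := by
    rw [Subalgebra.smul_def, smul_eq_mul, smul_mul_assoc, div_mul_cancel₀ _ hy0]
  exact hbxy ▸ I.smul_mem _ hy

end Primes

section Jaffard

variable {D : Type v} {K : Type u} [CommRing D] [Field K] [Algebra D K]

theorem exists_notMem_smul_eq_algebraMap_of_flat [IsFractionRing D K] {A : Subalgebra D K}
    [Module.Flat D A] {Q : Ideal A} (hQ : Q ≠ ⊤) (a : A) :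
    ∃ t, algebraMap D A t ∉ Q ∧ ∃ t', t • a = algebraMap D A t' := by
  have := (algebraMap D K).domain_nontrivial
  obtain ⟨x, y, hy, hxy⟩ := IsFractionRing.div_surjective D (a : K)
  have hy0 := IsFractionRing.to_map_ne_zero_of_mem_nonZeroDivisors (K := K) hy
  have hrel : ∑ i, ![y, -x] i • ![a, 1] i = 0 := by
    rw [Fin.sum_univ_two]
    refine Subtype.ext ?_
    change y • (a : K) + (-x) • (1 : K) = 0
    rw [← hxy, Algebra.smul_def, Algebra.smul_def, mul_div_cancel₀ _ hy0, map_neg, mul_one,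
      add_neg_cancel]
  obtain ⟨k, c, z, hz, hc⟩ := Module.Flat.isTrivialRelation_of_sum_smul_eq_zero hrel
  have hone : (1 : A) = ∑ j, c 1 j • z j := hz 1
  obtain ⟨j, hj⟩ : ∃ j, algebraMap D A (c 1 j) ∉ Q := by
    by_contra! hall
    refine hQ (Q.eq_top_iff_one.2 (hone ▸ Q.sum_mem fun j _ => ?_))
    exact Algebra.smul_def (c 1 j) (z j) ▸ Q.mul_mem_right _ (hall j)
  refine ⟨c 1 j, hj, c 0 j, Subtype.ext ?_⟩
  have hcj : y * c 0 j - x * c 1 j = 0 := by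
    simpa [Fin.sum_univ_two, ← sub_eq_add_neg] using hc j
  have hcjK : algebraMap D K (x * c 1 j) = algebraMap D K (y * c 0 j) :=
    congrArg _ (sub_eq_zero.1 hcj).symm
  change c 1 j • (a : K) = algebraMap D K (c 0 j)
  rw [Algebra.smul_def, ← hxy, mul_div_assoc', div_eq_iff hy0, mul_comm, ← map_mul, hcjK, map_mul,
    mul_comm]

theorem IsCompleteFamily.exists_map_ne_top [FaithfulSMul D K] {Θ : Set (Subalgebra D K)}
    (hΘ : IsCompleteFamily Θ) {I : Ideal D} (hI : I ≠ ⊤) :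
    ∃ T ∈ Θ, I.map (algebraMap D T) ≠ ⊤ := by
  by_contra! hall
  have hone : (1 : K) ∈ Submodule.map (Algebra.linearMap D K) I := by
    rw [hΘ I]
    simp only [Submodule.mem_iInf, Submodule.restrictScalars_mem]
    intro T hT
    have hle : I.map (algebraMap D T) ≤
        (extendTo (Submodule.map (Algebra.linearMap D K) I) T).comap (Algebra.linearMap T K) :=
      Ideal.map_le_iff_le_comap.2 fun i hi => Submodule.subset_span ⟨i, hi, rfl⟩
    exact hle (hall T hT ▸ Submodule.mem_top (x := (1 : T)))
  obtain ⟨i, hi, hi1⟩ := hone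
  have hi1 : i = 1 := FaithfulSMul.algebraMap_injective D K (hi1.trans (map_one _).symm)
  exact hI (I.eq_top_iff_one.2 (hi1 ▸ hi))

theorem exists_notMem_forall_smul_mem {F : Set (Subalgebra D K)} (hF : F.Finite) {P : Ideal D}
    [hP : P.IsPrime] {x : K} (h : ∀ A ∈ F, ∃ b ∉ P, b • x ∈ A) :
    ∃ b ∉ P, ∀ A ∈ F, b • x ∈ A := by
  induction F, hF using Set.Finite.induction_on with
  | empty => exact ⟨1, hP.one_notMem, fun _ => False.elim⟩
  | @insert A F _ _ ih =>
    obtain ⟨b, hb, hbx⟩ := h A (Set.mem_insert A F)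
    obtain ⟨c, hc, hcx⟩ := ih fun B hB => h B (Set.mem_insert_of_mem A hB)
    refine ⟨c * b, fun hcb => (hP.mem_or_mem hcb).elim hc hb, Set.forall_mem_insert.2 ⟨?_, ?_⟩⟩
    · exact mul_smul c b x ▸ A.smul_mem hbx c
    · exact fun B hB => by rw [mul_comm, mul_smul]; exact B.smul_mem (hcx B hB) b

variable [IsDomain D] [IsFractionRing D K] {M N : MaximalSpectrum D}

theorem IsJaffardFamily.exists_le_locAt {T : Subalgebra D K} (hT : T ≤ locAt K N)
    {Θ : Set (Subalgebra T K)} (hΘ : IsJaffardFamily Θ) :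
    ∃ A ∈ Θ, A.restrictScalars D ≤ locAt K N := by
  obtain ⟨P, hP⟩ := mem_sigmaSet_of_le_locAt hT
  obtain ⟨A, hA, hPA⟩ := hΘ.complete.exists_map_ne_top P.2.ne_top
  obtain ⟨Q, hQ, hPQ⟩ := Ideal.exists_le_maximal _ hPA
  set q : PrimeSpectrum T := PrimeSpectrum.comap (algebraMap T A) ⟨Q, hQ.isPrime⟩
  have hle : N.asIdeal ≤ (q.comap (algebraMap D T)).asIdeal := fun d hd =>
    hPQ (Ideal.mem_map_of_mem _ ((SetLike.ext_iff.1 (congrArg PrimeSpectrum.asIdeal hP) d).2 hd))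
  have hq : q.comap (algebraMap D T) = N.toPrimeSpectrum :=
    PrimeSpectrum.ext (N.isMaximal.eq_of_le (PrimeSpectrum.isPrime _).ne_top hle).symm
  have := hΘ.flat A hA
  refine ⟨A, hA, fun a ha => ?_⟩
  obtain ⟨t, htQ, t', hta⟩ := exists_notMem_smul_eq_algebraMap_of_flat hQ.ne_top ⟨a, ha⟩
  obtain ⟨c, hc, b, hcb⟩ := mem_locAt_iff.1 (hT t.2)
  obtain ⟨c', hc', b', hcb'⟩ := mem_locAt_iff.1 (hT t'.2)
  have hb : b ∉ N.asIdeal := mt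
    (mem_prime_iff_of_smul_eq_algebraMap hq hc (Subtype.ext hcb : c • t = algebraMap D T b)).2 htQ
  refine mem_locAt_iff.2
    ⟨c' * b, fun h => (N.isMaximal.isPrime.mem_or_mem h).elim hc' hb, c * b', ?_⟩
  have htaK : (t : K) * a = t' := congrArg Subtype.val hta
  rw [Algebra.smul_def] at hcb hcb' ⊢
  rw [map_mul, map_mul]
  linear_combination -algebraMap D K c' * a * hcb + algebraMap D K c * algebraMap D K c' * htaK
    + algebraMap D K c * hcb'

theorem IsJaffardFamily.notMem_sigmaSet_of_ne (hM : M.asIdeal ≠ ⊥) {T : Subalgebra D K}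
    {Θ : Set (Subalgebra T K)} (hΘ : IsJaffardFamily Θ) {S A : Subalgebra T K} (hS : S ∈ Θ)
    (hA : A ∈ Θ) (hAS : A ≠ S) (hSM : S.restrictScalars D = locAt K M) :
    M.toPrimeSpectrum ∉ sigmaSet (A.restrictScalars D) := by
  have hT : T ≤ locAt K M := hSM ▸ fun t ht => S.algebraMap_mem ⟨t, ht⟩
  have hMS : M.toPrimeSpectrum ∈ sigmaSet (S.restrictScalars D) :=
    mem_sigmaSet_of_le_locAt hSM.le
  rw [sigmaSet_restrictScalars] at hMS ⊢
  rintro ⟨P, hPA, hP⟩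
  obtain ⟨Q, hQS, hQ⟩ := hMS
  rw [eq_of_comap_eq_of_le_locAt hT hQ hP] at hQS
  have hbot : P.asIdeal = ⊥ := (hΘ.independent A hA S hS hAS).le ⟨hPA, hQS⟩
  refine hM ((congrArg PrimeSpectrum.asIdeal hP).symm.trans ?_)
  rw [PrimeSpectrum.comap_asIdeal, hbot]
  exact Ideal.comap_bot_of_injective _ (FaithfulSMul.algebraMap_injective D T)

/-- The `Θ`-members other than `D_M` become all of `K` after inverting the complement of `M`;
by local finiteness finitely many denominators suffice for a given `x`. -/
theorem IsJaffardOverringOf.exists_notMem_forall_smul_mem_locAt [Ring.DimensionLEOne D]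
    (hM : M.asIdeal ≠ ⊥) {T : Subalgebra D K} (h : IsJaffardOverringOf T (locAt K M)) (x : K) :
    ∃ b ∉ M.asIdeal, ∀ N ≠ M, T ≤ locAt K N → b • x ∈ locAt K N := by
  obtain ⟨S, hSM, Θ, hΘ, hS⟩ := h
  rcases eq_or_ne x 0 with rfl | hx
  · exact ⟨1, M.isMaximal.isPrime.one_notMem, fun N _ _ => by rw [smul_zero]; exact zero_mem _⟩
  obtain ⟨b, hb, hbx⟩ := exists_notMem_forall_smul_mem (P := M.asIdeal) (x := x)
    (F := (Subalgebra.restrictScalars D) '' {A ∈ Θ | A ≠ S ∧ x ∉ A})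
    (((hΘ.locallyFinite x hx).subset fun A hA => ⟨hA.1, fun h => hA.2.2 h.1⟩).image _) (by
      rintro _ ⟨A, ⟨hA, hAS, -⟩, rfl⟩
      exact exists_notMem_smul_mem_of_notMem_sigmaSet
        (hΘ.notMem_sigmaSet_of_ne hM hS hA hAS hSM) x)
  refine ⟨b, hb, fun N hNM hT => ?_⟩
  obtain ⟨A, hA, hAN⟩ := hΘ.exists_le_locAt hT
  have hAS : A ≠ S := by
    rintro rfl
    exact hNM (eq_of_locAt_le_locAt (hSM ▸ hAN)).symm
  by_cases hxA : x ∈ A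
  · exact hAN ((A.restrictScalars D).smul_mem hxA b)
  · exact hAN (hbx _ ⟨A, ⟨hA, hAS, hxA⟩, rfl⟩)

end Jaffard

section SharpFamilies

variable {D : Type v} {K : Type u} [CommRing D] [Field K] [Algebra D K]

theorem derivedFamily_zero (Θ : Set (Subalgebra D K)) : derivedFamily Θ 0 = Θ :=
  Ordinal.limitRecOn_zero ..

theorem derivedFamily_add_one (Θ : Set (Subalgebra D K)) (α : Ordinal.{u}) :
    derivedFamily Θ (α + 1) =
      {S ∈ derivedFamily Θ α | ¬ IsJaffardOverringOf (derivedRing Θ α) S} :=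
  Ordinal.limitRecOn_add_one ..

theorem derivedFamily_limit (Θ : Set (Subalgebra D K)) {α : Ordinal.{u}}
    (hα : Order.IsSuccLimit α) :
    derivedFamily Θ α = {S | ∀ β < α, S ∈ derivedFamily Θ β} :=
  Ordinal.limitRecOn_limit _ _ _ _ hα

/-- Members of `Θ` are treated in the order in which they are removed from the derived sequence:
those not containing `T = T_α` have been removed before stage `α`. -/
theorem IsSharpFamily.induction {Θ : Set (Subalgebra D K)} (hΘ : IsSharpFamily Θ)
    {p : Subalgebra D K → Prop}
    (h : ∀ S ∈ Θ, ∀ T, IsJaffardOverringOf T S → (∀ S' ∈ Θ, ¬ T ≤ S' → p S') → p S) :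
    ∀ S ∈ Θ, S ≠ ⊤ → p S := by
  have hremoved (α : Ordinal.{u}) : ∀ S ∈ Θ, S ∉ derivedFamily Θ α → p S := by
    induction α using Ordinal.limitRecOn with
    | zero => exact fun S hS hSα => absurd ((derivedFamily_zero Θ).ge hS) hSα
    | add_one α ih =>
      intro S hS hSα
      by_cases hmem : S ∈ derivedFamily Θ α
      · refine h S hS (derivedRing Θ α) ?_ fun S' hS' hle => ih S' hS' fun hS'α =>
          hle (sInf_le hS'α)
        by_contra hJ
        exact hSα (derivedFamily_add_one Θ α ▸ ⟨hmem, hJ⟩)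
      · exact ih S hS hmem
    | limit α hα ih =>
      intro S hS hSα
      obtain ⟨β, hβ, hSβ⟩ : ∃ β < α, S ∉ derivedFamily Θ β := by
        by_contra! hall
        exact hSα ((derivedFamily_limit Θ hα).ge hall)
      exact ih β hβ S hS hSβ
  exact fun S hS hne => hremoved (jaffardDegree Θ) S hS fun hmem =>
    hne (top_le_iff.1 (hΘ.ge.trans (sInf_le hmem)))

end SharpFamilies

section LocalToGlobal

variable {D : Type v} {K : Type u} [CommRing D] [IsDomain D] [Field K] [Algebra D K]
  [IsFractionRing D K] {M N : MaximalSpectrum D}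

theorem SemistarOperation.IsStable.mem_toFun_of_forall_ne {s : SemistarOperation D K}
    (hs : s.IsStable) {I : Submodule D K} {u : K}
    (hM : u ∈ s.toFun ((extendTo I (locAt K M)).restrictScalars D))
    (h : ∀ N ≠ M, u ∈ extendTo (s.toFun I) (locAt K N)) : u ∈ s.toFun I := by
  set V := (extendTo I (locAt K M)).restrictScalars D ⊓ Submodule.span D {u} with hV
  have hVI : V ≤ s.toFun I := by
    rintro v ⟨hvM, hvu⟩
    obtain ⟨d, rfl⟩ := Submodule.mem_span_singleton.1 hvu
    refine mem_of_forall_mem_extendTo_locAt fun N => ?_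
    rcases eq_or_ne N M with rfl | hN
    · exact extendTo_mono (s.le_toFun I) _ hvM
    · exact ((extendTo (s.toFun I) (locAt K N)).restrictScalars D).smul_mem d (h N hN)
  have huV : u ∈ s.toFun V := by
    rw [hV, hs]
    exact ⟨hM, s.le_toFun _ (Submodule.mem_span_singleton_self u)⟩
  exact s.idem I ▸ s.mono _ _ hVI huV

variable [Ring.DimensionLEOne D]

/-- If `D_M` is a Jaffard overring of `T` and `d • x ∈ I`, some `b ∉ M` makes `b / d` integral at
every other `D_N ⊇ T`; at the `D_N` not containing `T` the claim is already known. Thus `b • x` is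
locally in `s I` away from `M`. -/
theorem SemistarOperation.IsStable.mem_extendTo_toFun_locAt (hD : ¬ IsField D)
    (hsharp : IsUltimatelySharp D K) {s : SemistarOperation D K} (hs : s.IsStable)
    {I : Submodule D K} (hI : I ≠ ⊥) {x : K}
    (hx : ∀ M, x ∈ s.toFun ((extendTo I (locAt K M)).restrictScalars D))
    (M : MaximalSpectrum D) : x ∈ extendTo (s.toFun I) (locAt K M) := by
  have hbot (M : MaximalSpectrum D) : M.asIdeal ≠ ⊥ :=
    Ring.ne_bot_of_isMaximal_of_not_isField M.isMaximal hD
  refine hsharp.induction (p := fun S => x ∈ extendTo (s.toFun I) S) ?_ _ ⟨M, rfl⟩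
    (locAt_ne_top (hbot M))
  rintro _ ⟨M, rfl⟩ T hT ih
  obtain ⟨d, hd, hdx⟩ := exists_ne_zero_smul_mem_of_ne_bot hI x
  obtain ⟨b, hb, hbd⟩ :=
    hT.exists_notMem_forall_smul_mem_locAt (hbot M) (algebraMap D K d)⁻¹
  refine mem_extendTo_locAt.2 ⟨b, hb, hs.mem_toFun_of_forall_ne
    ((s.toFun _).smul_mem b (hx M)) fun N hN => ?_⟩
  by_cases hTN : T ≤ locAt K N
  · have hbx : b • x = (⟨_, hbd N hN hTN⟩ : locAt K N) • d • x := by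
      rw [Subalgebra.smul_def, smul_eq_mul, smul_mul_assoc, Algebra.smul_def d, inv_mul_cancel_left₀
        ((map_ne_zero_iff _ (IsFractionRing.injective D K)).2 hd)]
    rw [hbx]
    exact Submodule.smul_mem _ _ (le_extendTo _ _ (s.le_toFun I hdx))
  · exact ((extendTo _ _).restrictScalars D).smul_mem b (ih _ ⟨N, rfl⟩ hTN)

theorem SemistarOperation.IsStable.toFun_eq_iInf (hD : ¬ IsField D)
    (hsharp : IsUltimatelySharp D K) {s : SemistarOperation D K} (hs : s.IsStable)
    (I : Submodule D K) :
    s.toFun I = ⨅ M, s.toFun ((extendTo I (locAt K M)).restrictScalars D) := by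
  refine le_antisymm (le_iInf fun M => s.mono _ _ (le_extendTo I _)) fun x hx => ?_
  rw [Submodule.mem_iInf] at hx
  rcases eq_or_ne I ⊥ with rfl | hI
  · obtain ⟨M⟩ : Nonempty (MaximalSpectrum D) := inferInstance
    simpa only [extendTo_bot, Submodule.restrictScalars_bot] using hx M
  · exact mem_of_forall_mem_extendTo_locAt (hs.mem_extendTo_toFun_locAt hD hsharp hI hx)

end LocalToGlobal

namespace StableSemistar

variable {D : Type v} {K : Type u} [CommRing D] [IsDomain D] [Field K] [Algebra D K]
  [IsFractionRing D K]

/-- The operation `I ↦ ⋂ (I D_M)^{f M}` glued from operations `f M` on the localizations. -/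
noncomputable def glue (f : ∀ M : MaximalSpectrum D, StableSemistar (locAt K M) K) :
    StableSemistar D K :=
  ⟨{  toFun I := ⨅ M, ((f M).1.toFun (extendTo I (locAt K M))).restrictScalars D
      le_toFun I := le_iInf fun M => (le_extendTo I _).trans ((f M).1.le_toFun _)
      mono I J h := iInf_mono fun M => (f M).1.mono _ _ (extendTo_mono h _)
      idem I := by
        refine le_antisymm (iInf_mono fun M => ?_)
          (le_iInf fun M => (le_extendTo _ _).trans ((f M).1.le_toFun _))
        have hle : extendTo _ (locAt K M) ≤ (f M).1.toFun (extendTo I (locAt K M)) :=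
          Submodule.span_le.2 (iInf_le (fun M =>
            ((f M).1.toFun (extendTo I (locAt K M))).restrictScalars D) M)
        exact ((f M).1.mono _ _ hle).trans ((f M).1.idem _).le
      smul x I := by
        rcases eq_or_ne x 0 with rfl | hx
        · obtain ⟨M⟩ : Nonempty (MaximalSpectrum D) := inferInstance
          rw [zero_pointwise_smul, zero_pointwise_smul, eq_comm, eq_bot_iff]
          refine (iInf_le _ M).trans ?_
          rw [extendTo_bot, (f M).1.toFun_bot, Submodule.restrictScalars_bot]
        · ext z
          simp only [mem_pointwise_smul_iff_inv_mul_mem hx, Submodule.mem_iInf,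
            Submodule.restrictScalars_mem, extendTo_smul, ← (f _).1.smul] }, fun I J => by
    ext z
    simp only [Submodule.mem_inf, Submodule.mem_iInf, Submodule.restrictScalars_mem,
      extendTo_locAt_inf, (f _).2 _ _, forall_and]⟩

theorem glue_toFun (f : ∀ M : MaximalSpectrum D, StableSemistar (locAt K M) K)
    (I : Submodule D K) : (glue f).1.toFun I =
      ⨅ M, ((f M).1.toFun (extendTo I (locAt K M))).restrictScalars D :=
  rfl

variable [Ring.DimensionLEOne D]

theorem restrict_glue (f : ∀ M : MaximalSpectrum D, StableSemistar (locAt K M) K)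
    (N : MaximalSpectrum D) : (glue f).restrict (locAt K N) = f N := by
  ext1 I
  rcases eq_or_ne I ⊥ with rfl | hI
  · rw [SemistarOperation.toFun_bot, SemistarOperation.toFun_bot]
  have hne (M : MaximalSpectrum D) (hMN : M ≠ N) :
      (f M).1.toFun (extendTo (I.restrictScalars D) (locAt K M)) = ⊤ := by
    rw [extendTo_locAt_eq_top_of_ne hMN.symm hI, SemistarOperation.toFun_top]
  ext z
  change z ∈ (glue f).1.toFun (I.restrictScalars D) ↔ _
  rw [glue_toFun, Submodule.mem_iInf]
  constructor
  · exact fun h => extendTo_restrictScalars (locAt K N) I ▸ h N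
  · intro h M
    rcases eq_or_ne M N with rfl | hMN
    · rwa [extendTo_restrictScalars]
    · exact hne M hMN ▸ Submodule.mem_top

theorem glue_restrict (hD : ¬ IsField D) (hsharp : IsUltimatelySharp D K)
    (s : StableSemistar D K) :
    glue (fun M : MaximalSpectrum D => s.restrict (locAt K M)) = s := by
  ext1 I
  rw [s.2.toFun_eq_iInf hD hsharp I]
  rfl

/-- Restriction to the localizations, with inverse given by gluing. -/
noncomputable def restrictOrderIso (hD : ¬ IsField D) (hsharp : IsUltimatelySharp D K) :
    StableSemistar D K ≃o (∀ M : MaximalSpectrum D, StableSemistar (locAt K M) K) where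
  toFun s M := s.restrict (locAt K M)
  invFun := glue
  left_inv := glue_restrict hD hsharp
  right_inv f := funext (restrict_glue f)
  map_rel_iff' {s t} := by
    refine ⟨fun hst I => ?_, fun hst M I => hst (I.restrictScalars D)⟩
    rw [s.2.toFun_eq_iInf hD hsharp I, t.2.toFun_eq_iInf hD hsharp I]
    exact iInf_mono fun M => hst M (extendTo I (locAt K M))

end StableSemistar

section LocalRings

variable {R K : Type*} [CommRing R] [Field K] [Algebra R K]

theorem SemistarOperation.IsStable.exists_ne_top_one_mem_toFun {s : SemistarOperation R K}
    (hs : s.IsStable) {I : Submodule R K} {y : K} (hy : y ∈ s.toFun I) (hyI : y ∉ I) :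
    ∃ J : Ideal R, J ≠ ⊤ ∧ 1 ∈ s.toFun (IsLocalization.coeSubmodule K J) := by
  have hy0 : y ≠ 0 := fun h => hyI (h ▸ I.zero_mem)
  refine ⟨(y⁻¹ • I).comap (Algebra.linearMap R K), fun h => hyI ?_, ?_⟩
  · have h1 := (Ideal.eq_top_iff_one _).1 h
    rw [Submodule.mem_comap, Algebra.linearMap_apply, map_one,
      mem_pointwise_smul_iff_inv_mul_mem (inv_ne_zero hy0), inv_inv, mul_one] at h1
    exact h1
  · rw [IsLocalization.coeSubmodule, Submodule.map_comap_eq, ← Submodule.one_eq_range, hs, ← s.smul]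
    refine ⟨s.le_toFun 1 (Submodule.one_le.1 le_rfl),
      (mem_pointwise_smul_iff_inv_mul_mem (inv_ne_zero hy0)).2 ?_⟩
    rwa [inv_inv, mul_one]

theorem exists_pow_le_span_singleton [IsLocalRing R] [IsNoetherianRing R]
    [Ring.DimensionLEOne R] {J : Ideal R} (hJ : J ≠ ⊤) {a : R} (ha : a ≠ 0) :
    ∃ n : ℕ, J ^ n ≤ Ideal.span {a} := by
  refine Ideal.exists_pow_le_of_le_radical_of_fg ?_ (IsNoetherian.noetherian J)
  rw [Ideal.radical_eq_sInf]
  refine le_sInf fun P ⟨haP, hP⟩ => ?_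
  have hPbot : P ≠ ⊥ := (Submodule.ne_bot_iff P).2 ⟨a, haP (Ideal.mem_span_singleton_self a), ha⟩
  rw [IsLocalRing.eq_maximalIdeal (Ring.DimensionLEOne.maximalOfPrime hPbot hP)]
  exact IsLocalRing.le_maximalIdeal hJ

namespace StableSemistar

variable [IsFractionRing R K]

theorem eq_trivial_of_one_mem_toFun [IsLocalRing R] [IsNoetherianRing R] [Ring.DimensionLEOne R]
    {s : StableSemistar R K} {J : Ideal R} (hJ : J ≠ ⊤)
    (h : 1 ∈ s.1.toFun (IsLocalization.coeSubmodule K J)) : s = trivial R K := by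
  refine eq_trivial_of_toFun_one_eq_top (eq_top_iff.2 fun z _ => ?_)
  obtain ⟨x, a, ha, rfl⟩ := IsFractionRing.div_surjective R z
  have haK := IsFractionRing.to_map_ne_zero_of_mem_nonZeroDivisors (K := K) ha
  have := (algebraMap R K).domain_nontrivial
  obtain ⟨n, hn⟩ := exists_pow_le_span_singleton hJ (nonZeroDivisors.ne_zero ha)
  have hle : IsLocalization.coeSubmodule K J ^ n ≤ algebraMap R K a • 1 := by
    change Submodule.map (Algebra.ofId R K).toLinearMap J ^ n ≤ _
    rw [← Submodule.map_pow]
    refine (Submodule.map_mono hn).trans ?_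
    refine (IsLocalization.coeSubmodule_span_singleton K a).le.trans ?_
    rw [Submodule.span_singleton_le_iff_mem, mem_pointwise_smul_iff_inv_mul_mem haK,
      inv_mul_cancel₀ haK]
    exact Submodule.one_le.1 le_rfl
  have hinv : (algebraMap R K a)⁻¹ ∈ s.1.toFun 1 := by
    have h1 := s.1.mono _ _ hle (SemistarOperation.one_mem_toFun_pow h n)
    rwa [← s.1.smul, mem_pointwise_smul_iff_inv_mul_mem haK, mul_one] at h1
  rw [div_eq_mul_inv, ← Algebra.smul_def]
  exact (s.1.toFun 1).smul_mem x hinv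

theorem eq_identity_or_eq_trivial [IsLocalRing R] [IsNoetherianRing R] [Ring.DimensionLEOne R]
    (s : StableSemistar R K) : s = identity R K ∨ s = trivial R K := by
  refine or_iff_not_imp_left.2 fun hs => ?_
  obtain ⟨I, hI⟩ := not_forall.1 (mt eq_identity_iff.2 hs)
  obtain ⟨y, hy, hyI⟩ := Set.not_subset.1 fun h => hI (le_antisymm h (s.1.le_toFun I))
  obtain ⟨J, hJ, h1⟩ := s.2.exists_ne_top_one_mem_toFun hy hyI
  exact eq_trivial_of_one_mem_toFun hJ h1

theorem identity_ne_trivial (hR : ¬ IsField R) : identity R K ≠ trivial R K := by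
  intro h
  have htop : (1 : Submodule R K) = ⊤ := by
    rw [← identity_toFun (1 : Submodule R K), h, trivial_toFun one_ne_zero]
  have hsurj : Function.Surjective (algebraMap R K) := fun x =>
    Submodule.mem_one.1 (htop ▸ Submodule.mem_top)
  exact hR ((RingEquiv.ofBijective (algebraMap R K)
    ⟨IsFractionRing.injective R K, hsurj⟩).toMulEquiv.isField (Field.toIsField K))

end StableSemistar

end LocalRings

section OneDimensional

variable {D : Type v} {K : Type u} [CommRing D] [IsDomain D] [Field K] [Algebra D K]
  [IsFractionRing D K]

theorem locAt_not_isField (hD : ¬ IsField D) (M : MaximalSpectrum D) : ¬ IsField (locAt K M) :=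
  IsLocalization.AtPrime.not_isField D
    (Ring.ne_bot_of_isMaximal_of_not_isField M.isMaximal hD) (locAt K M)

namespace StableSemistar

theorem locAt_eq_identity_or_eq_trivial [Ring.DimensionLEOne D] (M : MaximalSpectrum D)
    [IsNoetherianRing (Localization.AtPrime M.asIdeal)] (s : StableSemistar (locAt K M) K) :
    s = identity (locAt K M) K ∨ s = trivial (locAt K M) K :=
  have := IsLocalization.AtPrime.isLocalRing (locAt K M) M.asIdeal
  have := Ring.DimensionLEOne.localization (locAt K M) M.asIdeal.primeCompl_le_nonZeroDivisors
  have := isNoetherianRing_of_ringEquiv (Localization.AtPrime M.asIdeal)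
    (IsLocalization.algEquiv M.asIdeal.primeCompl (Localization.AtPrime M.asIdeal)
      (locAt K M)).toRingEquiv
  eq_identity_or_eq_trivial s

variable [Ring.DimensionLEOne D] (hD : ¬ IsField D)
  [∀ M : MaximalSpectrum D, IsNoetherianRing (Localization.AtPrime M.asIdeal)]

open scoped Classical in
/-- Families of stable operations on the localizations, encoded by the set of those maximal ideals
at which the operation is the identity. -/
noncomputable def localEquivSet :
    (∀ M : MaximalSpectrum D, StableSemistar (locAt K M) K) ≃ Set (MaximalSpectrum D) where
  toFun f := {M | ∀ I, (f M).1.toFun I = I}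
  invFun S M := if M ∈ S then identity (locAt K M) K else trivial (locAt K M) K
  left_inv f := by
    funext M
    change (if ∀ I, (f M).1.toFun I = I then _ else _) = _
    split_ifs with hM
    · exact (eq_identity_iff.2 hM).symm
    · exact ((locAt_eq_identity_or_eq_trivial M (f M)).resolve_left (mt eq_identity_iff.1 hM)).symm
  right_inv S := by
    ext M
    change (∀ I, (if M ∈ S then _ else _ : StableSemistar (locAt K M) K).1.toFun I = I) ↔ _
    rw [← eq_identity_iff]
    split_ifs with hM
    · exact iff_of_true rfl hM
    · exact iff_of_false (identity_ne_trivial (locAt_not_isField hD M)).symm hM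

theorem glue_localEquivSet_symm (S : Set (MaximalSpectrum D)) {I : Submodule D K} (hI : I ≠ ⊥) :
    (glue ((localEquivSet (K := K) hD).symm S)).1.toFun I =
      ⨅ M ∈ S, (extendTo I (locAt K M)).restrictScalars D := by
  classical
  rw [glue_toFun]
  refine iInf_congr fun M => ?_
  change ((if M ∈ S then _ else _ : StableSemistar (locAt K M) K).1.toFun _).restrictScalars D = _
  by_cases hM : M ∈ S
  · rw [if_pos hM, iInf_pos hM, identity_toFun]
  · rw [if_neg hM, iInf_neg hM, trivial_toFun (extendTo_ne_bot hI _),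
      Submodule.restrictScalars_top]

end StableSemistar

end OneDimensional

namespace IsAlmostDedekind

variable {D : Type v} [CommRing D] [IsDomain D]

theorem not_isField (hD : IsAlmostDedekind D) : ¬ IsField D := by
  intro hF
  obtain ⟨M⟩ : Nonempty (MaximalSpectrum D) := inferInstance
  have := hD M
  have hbij := hF.localization_map_bijective (M := M.asIdeal.primeCompl)
    (Rₘ := Localization.AtPrime M.asIdeal) fun h => h M.asIdeal.zero_mem
  exact IsDiscreteValuationRing.not_isField (Localization.AtPrime M.asIdeal)
    ((RingEquiv.ofBijective _ hbij).symm.toMulEquiv.isField hF)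

theorem dimensionLEOne (hD : IsAlmostDedekind D) : Ring.DimensionLEOne D := by
  refine ⟨fun {p} hp hprime => ?_⟩
  obtain ⟨q, hq, hpq⟩ := p.exists_le_maximal hprime.ne_top
  have := hD ⟨q, hq⟩
  have hdisj : Disjoint (q.primeCompl : Set D) p := hpq.disjoint_compl_left
  have hmap : p.map (algebraMap D (Localization.AtPrime q)) ≠ ⊥ :=
    mt (Ideal.map_eq_bot_iff_of_injective (IsLocalization.injective _
      q.primeCompl_le_nonZeroDivisors)).1 hp
  have hmax := Ring.DimensionLEOne.maximalOfPrime hmap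
    (IsLocalization.isPrime_of_isPrime_disjoint q.primeCompl _ p hprime hdisj)
  have hpq' : p = q := by
    rw [← IsLocalization.under_map_of_isPrime_disjoint q.primeCompl (Localization.AtPrime q) hprime
      hdisj, IsLocalRing.eq_maximalIdeal hmax]
    exact IsLocalization.AtPrime.under_maximalIdeal (Localization.AtPrime q) q
  exact hpq' ▸ hq

end IsAlmostDedekind

open StableSemistar in
theorem mainTheorem7_general (D : Type v) (K : Type u) [CommRing D] [IsDomain D] [Field K]
    [Algebra D K] [IsFractionRing D K] [Ring.DimensionLEOne D] (hD : ¬ IsField D)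
    [∀ M : MaximalSpectrum D, IsNoetherianRing (Localization.AtPrime M.asIdeal)]
    (hsharp : IsUltimatelySharp D K) :
    (∃ e : StableSemistar D K ≃o (∀ M : MaximalSpectrum D, StableSemistar (locAt K M) K),
      (∀ s M, e s M = StableSemistar.restrict s (locAt K M)) ∧
      (∀ f I, (e.symm f).1.toFun I =
        ⨅ M, ((f M).1.toFun (extendTo I (locAt K M))).restrictScalars D)) ∧
    (∀ M : MaximalSpectrum D, ∃ s₀ s₁ : StableSemistar (locAt K M) K, s₀ ≠ s₁ ∧
      (∀ I, s₀.1.toFun I = I) ∧ (∀ I, I ≠ ⊥ → s₁.1.toFun I = ⊤) ∧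
      ∀ s, s = s₀ ∨ s = s₁) ∧
    (∃ b : StableSemistar D K ≃ Set (MaximalSpectrum D),
      (∀ s, b s = {M | ∀ I, (StableSemistar.restrict s (locAt K M)).1.toFun I = I}) ∧
      (∀ S I, I ≠ ⊥ → (b.symm S).1.toFun I =
        ⨅ M ∈ S, (extendTo I (locAt K M)).restrictScalars D)) := by
  refine ⟨⟨restrictOrderIso hD hsharp, fun _ _ => rfl, glue_toFun⟩, fun M => ?_,
    (restrictOrderIso hD hsharp).toEquiv.trans (localEquivSet hD), fun _ => rfl,
    fun S _ hI => glue_localEquivSet_symm hD S hI⟩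
  exact ⟨identity _ K, trivial _ K, identity_ne_trivial (locAt_not_isField hD M), identity_toFun,
    fun _ hI => trivial_toFun hI, locAt_eq_identity_or_eq_trivial M⟩

theorem mainTheorem7 (D : Type v) (K : Type u) [CommRing D] [IsDomain D] [Field K]
    [Algebra D K] [IsFractionRing D K]
    (hD : IsAlmostDedekind D) (hsharp : IsUltimatelySharp D K) :
    -- restriction is an order isomorphism of `Stab(D)` onto the product of the `Stab(D_M)`
    (∃ e : StableSemistar D K ≃o (∀ M : MaximalSpectrum D, StableSemistar (locAt K M) K),
      (∀ s M, e s M = StableSemistar.restrict s (locAt K M)) ∧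
      (∀ f I, (e.symm f).1.toFun I =
        ⨅ M, ((f M).1.toFun (extendTo I (locAt K M))).restrictScalars D)) ∧
    -- every `D_M` has exactly two stable operations
    (∀ M : MaximalSpectrum D, ∃ s₀ s₁ : StableSemistar (locAt K M) K, s₀ ≠ s₁ ∧
      (∀ I, s₀.1.toFun I = I) ∧ (∀ I, I ≠ ⊥ → s₁.1.toFun I = ⊤) ∧
      ∀ s, s = s₀ ∨ s = s₁) ∧
    -- the resulting bijection of `Stab(D)` with the power set of `Max(D)`
    (∃ b : StableSemistar D K ≃ Set (MaximalSpectrum D),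
      (∀ s, b s = {M | ∀ I, (StableSemistar.restrict s (locAt K M)).1.toFun I = I}) ∧
      (∀ S I, I ≠ ⊥ → (b.symm S).1.toFun I =
        ⨅ M ∈ S, (extendTo I (locAt K M)).restrictScalars D)) :=
  have := hD.dimensionLEOne
  have (M : MaximalSpectrum D) : IsNoetherianRing (Localization.AtPrime M.asIdeal) :=
    have := hD M
    inferInstance
  mainTheorem7_general D K hD.not_isField hsharp
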